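/- Let $W$ be a group. A finite subset $S\subseteq W$ is a set of Coxeter generators of $W$ (and $(W,S)$ is a Coxeter system) if $W$ has the presentation $\langle S\mid (st)^{m(s,t)}=1\ (s,t\in S)\rangle$ with $m(s,s)=1$ and $m(s,t)=m(t,s)\in\{2,3,\dots,\infty\}$ for $s\neq t$, the relation being omitted when $m(s,t)=\infty$; $(W,S)$ is right-angled if $m(s,t)\in\{2,\infty\}$ for all $s\ne t$. For $A\subseteq S$ let $W_A$ be the subgroup generated by $A$; let $N(W,S)$ be the set of nonempty $A\subseteq S$ with $W_A$ finite, and $N^*(W,S)$ the set of elements of $N(W,S)$ that are maximal under inclusion. Let $q:W\to W/[W,W]$ be the quotient map. Theorem. Let $(W,S)$ be a right-angled Coxeter system and let $S'$ be another finite set of Coxeter generators of $W$. Then for each $A\in N^*(W,S)$ there is a unique $A^*\in N^*(W,S')$ with $q(W_A)=q(W_{A^*})$, and the map $A\mapsto A^*$ is a bijection from $N^*(W,S)$ to $N^*(W,S')$. Moreover, for all $r\ge 1$, $s\ge 0$ and $A_1,\dots,A_r,B_1,\dots,B_s\in N^*(W,S)$, $$\Bigl|\bigcap_{i=1}^r A_i\Bigr|=\Bigl|\bigcap_{i=1}^r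 A_i^*\Bigr|\qquad\text{and}\qquad \Bigl|\bigcap_{i=1}^r A_i\setminus\bigcup_{j=1}^s B_j\Bigr|=\Bigl|\bigcap_{i=1}^r A_i^*\setminus\bigcup_{j=1}^s B_j^*\Bigr|.$$ -/

import Mathlib

/-- `S` is a finite set of Coxeter generators of `W` with Coxeter matrix `M`: the inclusion of `S`
in `W` induces an isomorphism onto `W` from the group presented by generators `S` and relations
`(s t) ^ M s t = 1`. In a Coxeter matrix the entry `0` stands for `∞` (no relation). -/
def IsCoxeterSystemWith {W : Type*} [Group W] (S : Set W) (M : CoxeterMatrix S) : Prop :=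
  S.Finite ∧ ∃ cs : CoxeterSystem M W, ∀ s : S, cs.simple s = (s : W)

/-- `S` is a (finite) set of Coxeter generators of `W`, i.e. `(W, S)` is a Coxeter system. -/
def IsCoxeterGenerators {W : Type*} [Group W] (S : Set W) : Prop :=
  ∃ M : CoxeterMatrix S, IsCoxeterSystemWith S M

/-- `(W, S)` is a right-angled Coxeter system: all off-diagonal entries of its Coxeter matrix
are `2` or `∞` (written `0`). -/
def IsRightAngledCoxeterGenerators {W : Type*} [Group W] (S : Set W) : Prop :=
  ∃ M : CoxeterMatrix S, IsCoxeterSystemWith S M ∧ ∀ s t : S, s ≠ t → M s t = 2 ∨ M s t = 0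

/-- The standard subgroup `W_A` generated by a set `A`. -/
def standardSubgroup {W : Type*} [Group W] (A : Set W) : Subgroup W :=
  Subgroup.closure A

/-- The nerve `N(W, S)`: nonempty subsets `A ⊆ S` such that `W_A` is finite. -/
def coxeterNerve {W : Type*} [Group W] (S : Set W) : Set (Set W) :=
  {A | A.Nonempty ∧ A ⊆ S ∧ Finite (standardSubgroup A)}

/-- `N*(W, S)`: the maximal elements of the nerve. -/
def maximalNerve {W : Type*} [Group W] (S : Set W) : Set (Set W) :=
  {A | A ∈ coxeterNerve S ∧ ∀ B ∈ coxeterNerve S, A ⊆ B → A = B}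

/-- The image `q(W_A)` of the standard subgroup `W_A` under the quotient map
`q : W → W / [W, W]`. -/
def abelianizedStandardSubgroup {W : Type*} [Group W] (A : Set W) : Subgroup (Abelianization W) :=
  (standardSubgroup A).map Abelianization.of

/-! The abelianization of a right-angled Coxeter group is the F_2-vector space with basis `S`, and
q(W_A) is the span of A. So q(W_A) determines A (`exists_support`), and an intersection of such
subgroups has order 2 to the size of the intersection of the sets. It remains to see that the
subgroups q(W_A), for A maximal, do not depend on the generators.

Every finite subgroup is conjugate into some W_T with T pairwise commuting
(`exists_conj_le_parabolic_clique`), and conjugation is invisible under q. Torsion elements are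
therefore involutions, which makes S' right-angled too. For A in N*(W,S) this gives A' ⊆ S' and then
C ⊆ S with q(W_A) ≤ q(W_A') ≤ q(W_C); maximality of A forces A = C, so both inclusions are
equalities. Set differences follow from intersections by inclusion-exclusion.

Conjugacy comes from the splitting of W as the amalgam of W_{S∖s} and W_{star s} over W_{link s}.
The kernel of the retraction killing s is a free product of groups of order two indexed by
W_{S∖s}/W_{link s}; reduced words in these letters are the vertices of its Cayley tree, and W acts
on it. A finite subgroup fixes a vertex or preserves an edge, so it is conjugate into W_{S∖s} or
W_{star s}. A minimal T into which it can be conjugated must then be a clique. -/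

namespace CoxeterSystem

/-! ### Retractions onto parabolic subgroups -/

variable {B W : Type*} [Group W] {M : CoxeterMatrix B}

/-- Off-diagonal entries of `M` are `2` or `∞`. -/
def IsRightAngledMatrix (M : CoxeterMatrix B) : Prop :=
  ∀ i j, i ≠ j → M i j = 2 ∨ M i j = 0

theorem IsRightAngledMatrix.isLiftable (hM : IsRightAngledMatrix M) {G : Type*} [Monoid G]
    {f : B → G} (hsq : ∀ i, f i * f i = 1) (hcomm : ∀ i j, M i j = 2 → Commute (f i) (f j)) :
    M.IsLiftable f := by
  intro i j
  rcases eq_or_ne i j with rfl | hij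
  · simp [hsq]
  · rcases hM i j hij with h | h
    · rw [h, (hcomm i j h).mul_pow, pow_two, pow_two, hsq, hsq, one_mul]
    · rw [h, pow_zero]

variable (cs : CoxeterSystem M W)

theorem commute_simple_of_eq_two {i j : B} (h : M i j = 2) :
    Commute (cs.simple i) (cs.simple j) := by
  have h1 := cs.simple_mul_simple_pow i j
  rw [h, pow_two, mul_eq_one_iff_eq_inv] at h1
  simpa [Commute, SemiconjBy] using h1

/-- The subgroup generated by the simple reflections indexed by `T`. -/
def parabolic (T : Set B) : Subgroup W := Subgroup.closure (cs.simple '' T)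

theorem simple_mem_parabolic {T : Set B} {i : B} (h : i ∈ T) : cs.simple i ∈ cs.parabolic T :=
  Subgroup.subset_closure ⟨i, h, rfl⟩

open Classical in
/-- The endomorphism of a right-angled Coxeter group that kills the simple reflections outside
`T` and fixes those in `T`. -/
noncomputable def retraction (hM : IsRightAngledMatrix M) (T : Set B) : W →* W :=
  cs.lift ⟨fun i ↦ if i ∈ T then cs.simple i else 1, hM.isLiftable
    (fun i ↦ by split_ifs <;> simp)
    (fun i j h ↦ by
      have := cs.commute_simple_of_eq_two h
      split_ifs <;> simp [this])⟩

variable (hM : IsRightAngledMatrix M)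

open Classical in
theorem retraction_simple (T : Set B) (i : B) :
    cs.retraction hM T (cs.simple i) = if i ∈ T then cs.simple i else 1 := by
  rw [retraction, cs.lift_apply_simple]

theorem retraction_mem (T : Set B) (w : W) : cs.retraction hM T w ∈ cs.parabolic T := by
  induction w using cs.simple_induction with
  | simple i =>
    rw [retraction_simple]
    split_ifs with h
    · exact cs.simple_mem_parabolic h
    · exact one_mem _
  | one => rw [map_one]; exact one_mem _
  | mul w w' h h' => rw [map_mul]; exact mul_mem h h'

theorem retraction_eq_self {T : Set B} {w : W} (hw : w ∈ cs.parabolic T) :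
    cs.retraction hM T w = w := by
  induction hw using Subgroup.closure_induction with
  | mem x hx =>
    obtain ⟨i, hi, rfl⟩ := hx
    rw [retraction_simple, if_pos hi]
  | one => exact map_one _
  | mul x y _ _ hx hy => rw [map_mul, hx, hy]
  | inv x _ hx => rw [map_inv, hx]

/-- This is what allows two conjugations, into W_T and into W_U, to be combined into one into
W_{T∩U}. -/
theorem retraction_mem_inter (T U : Set B) {w : W} (hw : w ∈ cs.parabolic U) :
    cs.retraction hM T w ∈ cs.parabolic (T ∩ U) := by
  induction hw using Subgroup.closure_induction with
  | mem x hx =>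
    obtain ⟨i, hi, rfl⟩ := hx
    rw [retraction_simple]
    split_ifs with h
    · exact cs.simple_mem_parabolic ⟨h, hi⟩
    · exact one_mem _
  | one => rw [map_one]; exact one_mem _
  | mul x y _ _ hx hy => rw [map_mul]; exact mul_mem hx hy
  | inv x _ hx => rw [map_inv]; exact inv_mem hx

end CoxeterSystem

/-! ### The regular tree of reduced words -/

namespace ReducedWord

variable (X : Type*)

/-- Words without equal adjacent letters: the vertices of a regular tree. -/
abbrev Vertex : Type _ := {l : List X // l.IsChain (· ≠ ·)}

variable {X}

open Classical in
/-- The distance in the tree of reduced words. -/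
noncomputable def treeDist : List X → List X → ℕ
  | [], l => l.length
  | _ :: l, [] => l.length + 1
  | a :: l, b :: l' => if a = b then treeDist l l' else l.length + l'.length + 2

theorem treeDist_cons (a : X) (l l' : List X) : treeDist (a :: l) (a :: l') = treeDist l l' := by
  simp [treeDist]

theorem treeDist_of_head?_ne {l l' : List X} (h : ∀ a ∈ l.head?, a ∉ l'.head?) :
    treeDist l l' = l.length + l'.length := by
  match l, l' with
  | [], l' => simp [treeDist]
  | a :: l, [] => simp [treeDist]
  | a :: l, b :: l' =>
    have : a ≠ b := by rintro rfl; simp at h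
    simp only [treeDist, this, if_false, List.length_cons]
    omega

theorem treeDist_map {Y : Type*} {f : X → Y} (hf : Function.Injective f) (l l' : List X) :
    treeDist (l.map f) (l'.map f) = treeDist l l' := by
  induction l generalizing l' with
  | nil => simp [treeDist]
  | cons a l ih =>
    cases l' with
    | nil => simp [treeDist]
    | cons b l' => by_cases h : a = b <;> simp [treeDist, hf.eq_iff, ih, h]

open Classical in
/-- Cancel a leading `a`, or put one in front. -/
noncomputable def toggle (a : X) : List X → List X
  | [] => [a]
  | b :: l => if a = b then l else a :: b :: l

theorem toggle_cons (a : X) (l : List X) : toggle a (a :: l) = l := by simp [toggle]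

theorem toggle_of_notMem {a : X} {l : List X} (h : a ∉ l.head?) : toggle a l = a :: l := by
  cases l with
  | nil => rfl
  | cons b l =>
    have : a ≠ b := by rintro rfl; simp at h
    simp [toggle, this]

theorem isChain_cons_iff_notMem {a : X} {l : List X} :
    (a :: l).IsChain (· ≠ ·) ↔ a ∉ l.head? ∧ l.IsChain (· ≠ ·) := by
  cases l with
  | nil => simp
  | cons b l => simp [eq_comm]

theorem toggle_cases (a : X) {l : List X} (hl : l.IsChain (· ≠ ·)) :
    (∃ l', l = a :: l' ∧ toggle a l = l' ∧ a ∉ l'.head?) ∨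
      (a ∉ l.head? ∧ toggle a l = a :: l) := by
  by_cases h : a ∈ l.head?
  · left
    obtain ⟨l', rfl⟩ : ∃ l', l = a :: l' := by
      cases l with
      | nil => simp at h
      | cons b l => exact ⟨l, by simpa [eq_comm] using h⟩
    exact ⟨l', rfl, toggle_cons a l', (isChain_cons_iff_notMem.1 hl).1⟩
  · exact .inr ⟨h, toggle_of_notMem h⟩

theorem toggle_isChain (a : X) {l : List X} (hl : l.IsChain (· ≠ ·)) :
    (toggle a l).IsChain (· ≠ ·) := by
  rcases toggle_cases a hl with ⟨l', rfl, h, -⟩ | ⟨h, h'⟩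
  · rw [h]; exact (isChain_cons_iff_notMem.1 hl).2
  · rw [h']; exact isChain_cons_iff_notMem.2 ⟨h, hl⟩

theorem toggle_toggle (a : X) {l : List X} (hl : l.IsChain (· ≠ ·)) :
    toggle a (toggle a l) = l := by
  rcases toggle_cases a hl with ⟨l', rfl, h, h'⟩ | ⟨h, h'⟩
  · rw [h, toggle_of_notMem h']
  · rw [h', toggle_cons]

theorem toggle_map {Y : Type*} {f : X → Y} (hf : Function.Injective f) (a : X) (l : List X) :
    toggle (f a) (l.map f) = (toggle a l).map f := by
  cases l with
  | nil => simp [toggle]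
  | cons b l =>
    by_cases h : a = b <;> simp [toggle, hf.eq_iff, h]

/-- Toggling is left multiplication by a generator in a free product of groups of order two. Tree
edges change the last letter, that is, they multiply on the right, so distances are kept. -/
theorem treeDist_toggle (a : X) {l l' : List X} (hl : l.IsChain (· ≠ ·))
    (hl' : l'.IsChain (· ≠ ·)) : treeDist (toggle a l) (toggle a l') = treeDist l l' := by
  rcases toggle_cases a hl with ⟨k, rfl, h, hk⟩ | ⟨h, hk⟩ <;>
    rcases toggle_cases a hl' with ⟨k', rfl, h', hk'⟩ | ⟨h', hk'⟩
  · rw [h, h', treeDist_cons]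
  · rw [h, hk', treeDist_of_head?_ne, treeDist_of_head?_ne]
    · simp; omega
    · simpa using h'
    · intro b hb hb'
      obtain rfl : a = b := by simpa using hb'
      exact hk hb
  · rw [hk, h', treeDist_of_head?_ne, treeDist_of_head?_ne]
    · simp; omega
    · intro b hb hb'
      obtain rfl : a = b := by simpa using hb'
      exact h hb
    · simpa using hk'
  · rw [hk, hk', treeDist_cons]

/-- Strict convexity of the distance: `[a]` is an interior vertex of the geodesic from `[]` to `a ::
c`. It makes circumcentres unique up to an edge. -/
theorem treeDist_singleton_lt {a : X} {c : List X} (hc : c ≠ []) (k : List X) :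
    treeDist [a] k < max (treeDist [] k) (treeDist (a :: c) k) := by
  by_cases h : a ∈ k.head?
  · obtain ⟨k', rfl⟩ : ∃ k', k = a :: k' := by
      cases k with
      | nil => simp at h
      | cons b k => exact ⟨k, by simpa [eq_comm] using h⟩
    simp [treeDist]
  · have := List.length_pos_iff.2 hc
    rw [treeDist_of_head?_ne (by simpa using h), treeDist_of_head?_ne (by simp),
      treeDist_of_head?_ne (by simpa using h)]
    simp
    omega

/-- Letterwise action of a group on the tree of reduced words. -/
def mapHom (G : Type*) [Group G] [MulAction G X] : G →* Equiv.Perm (Vertex X) where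
  toFun g :=
    { toFun := fun l ↦ ⟨l.1.map (g • ·), (List.isChain_map _).2 (l.2.imp fun _ _ h ↦ by simpa)⟩
      invFun := fun l ↦ ⟨l.1.map (g⁻¹ • ·), (List.isChain_map _).2 (l.2.imp fun _ _ h ↦ by simpa)⟩
      left_inv := fun l ↦ Subtype.ext (by simp [Function.comp_def])
      right_inv := fun l ↦ Subtype.ext (by simp [Function.comp_def]) }
  map_one' := Equiv.ext fun l ↦ Subtype.ext <|
    (List.map_congr_left fun x _ ↦ one_smul G x).trans (List.map_id' l.1)
  map_mul' g h := Equiv.ext fun l ↦ Subtype.ext <|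
    (List.map_congr_left fun x _ ↦ mul_smul g h x).trans
      (List.map_map (l := l.1) (f := (h • ·)) (g := (g • ·))).symm

theorem mapHom_apply {G : Type*} [Group G] [MulAction G X] (g : G) (l : Vertex X) :
    (mapHom G g l).1 = l.1.map (g • ·) := rfl

/-- `toggle` as an involution of the tree. -/
noncomputable def togglePerm (a : X) : Equiv.Perm (Vertex X) where
  toFun l := ⟨toggle a l.1, toggle_isChain a l.2⟩
  invFun l := ⟨toggle a l.1, toggle_isChain a l.2⟩
  left_inv l := Subtype.ext (toggle_toggle a l.2)
  right_inv l := Subtype.ext (toggle_toggle a l.2)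

theorem togglePerm_apply (a : X) (l : Vertex X) : (togglePerm a l).1 = toggle a l.1 := rfl

theorem togglePerm_mul_self (a : X) : togglePerm a * togglePerm a = 1 :=
  Equiv.ext fun l ↦ Subtype.ext (toggle_toggle a l.2)

theorem commute_togglePerm_mapHom {G : Type*} [Group G] [MulAction G X] {a : X} {g : G}
    (h : g • a = a) : Commute (togglePerm a) (mapHom G g) := by
  refine Equiv.ext fun l ↦ Subtype.ext ?_
  have := toggle_map (MulAction.injective g) a l.1
  rw [h] at this
  exact this

end ReducedWord

/-! ### Action on the tree of the splitting at `s` -/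

namespace CoxeterSystem

open ReducedWord

variable {B W : Type*} [Group W] {M : CoxeterMatrix B}
variable (cs : CoxeterSystem M W) (hM : IsRightAngledMatrix M) (s : B)

/-- Elements whose image under the retraction killing `s` lies in the parabolic subgroup
generated by the simple reflections that commute with `s`. -/
noncomputable def linkSubgroup : Subgroup W :=
  (cs.parabolic {j | M s j = 2}).comap (cs.retraction hM {s}ᶜ)

theorem commute_of_mem_parabolic_link {w : W} (hw : w ∈ cs.parabolic {j | M s j = 2}) :
    Commute (cs.simple s) w := by
  induction hw using Subgroup.closure_induction with
  | mem x hx =>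
    obtain ⟨i, hi, rfl⟩ := hx
    exact cs.commute_simple_of_eq_two hi
  | one => exact Commute.one_right _
  | mul x y _ _ hx hy => exact hx.mul_right hy
  | inv x _ hx => exact hx.inv_right

theorem retraction_simple_self : cs.retraction hM {s}ᶜ (cs.simple s) = 1 := by
  simp [retraction_simple]

theorem retraction_simple_of_ne {i : B} (h : i ≠ s) :
    cs.retraction hM {s}ᶜ (cs.simple i) = cs.simple i := by
  simp [retraction_simple, h]

/-- `linkSubgroup` contains the kernel of the retraction, which is normal, so W acts on letters
through the retraction. -/
theorem smul_eq_of_retraction_eq {g h : W}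
    (hgh : cs.retraction hM {s}ᶜ g = cs.retraction hM {s}ᶜ h) (x : W ⧸ cs.linkSubgroup hM s) :
    g • x = h • x := by
  induction x using QuotientGroup.induction_on with
  | H k =>
    refine QuotientGroup.eq.2 ?_
    simp [linkSubgroup, Subgroup.mem_comap, hgh]

/-- The base letter. -/
noncomputable def baseLetter : W ⧸ cs.linkSubgroup hM s := ((1 : W) : W ⧸ cs.linkSubgroup hM s)

theorem smul_baseLetter_eq_iff {g : W} :
    g • cs.baseLetter hM s = cs.baseLetter hM s ↔
      cs.retraction hM {s}ᶜ g ∈ cs.parabolic {j | M s j = 2} := by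
  have : g • cs.baseLetter hM s = ((g * 1 : W) : W ⧸ cs.linkSubgroup hM s) := rfl
  rw [this, baseLetter, eq_comm, QuotientGroup.eq]
  simp [linkSubgroup]

open Classical in
/-- The action of a right-angled Coxeter group on the tree of reduced words whose vertices are
the cosets of the subgroup generated by the simple reflections other than `s`. -/
noncomputable def treeAction : W →* Equiv.Perm (Vertex (W ⧸ cs.linkSubgroup hM s)) :=
  cs.lift ⟨fun i ↦ if i = s then togglePerm (cs.baseLetter hM s) else mapHom W (cs.simple i),
    hM.isLiftable
      (fun i ↦ by
        split_ifs
        · exact togglePerm_mul_self _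
        · rw [← map_mul, simple_mul_simple_self, map_one])
      (fun i j h ↦ by
        -- The only relations mixing the two kinds of generators come from the link of `s`, whose
        -- elements fix the base letter and so commute with toggling it.
        have key : ∀ k, M s k = 2 → k ≠ s → cs.simple k • cs.baseLetter hM s =
            cs.baseLetter hM s := fun k hk hks ↦ by
          rw [smul_baseLetter_eq_iff, retraction_simple_of_ne cs hM s hks]
          exact cs.simple_mem_parabolic hk
        split_ifs with hi hj hj
        · exact Commute.refl _
        · subst hi
          exact commute_togglePerm_mapHom (key j h hj)
        · subst hj
          rw [M.symmetric] at h
          exact (commute_togglePerm_mapHom (key i h hi)).symm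
        · exact (cs.commute_simple_of_eq_two h).map (mapHom W))⟩

theorem treeAction_simple_self :
    cs.treeAction hM s (cs.simple s) = togglePerm (cs.baseLetter hM s) := by
  rw [treeAction, cs.lift_apply_simple]
  simp

theorem treeAction_simple_of_ne {i : B} (h : i ≠ s) :
    cs.treeAction hM s (cs.simple i) = mapHom W (cs.simple i) := by
  rw [treeAction, cs.lift_apply_simple]
  simp [h]

theorem treeAction_retraction (w : W) :
    cs.treeAction hM s (cs.retraction hM {s}ᶜ w) = mapHom W w := by
  suffices (cs.treeAction hM s).comp (cs.retraction hM {s}ᶜ) = mapHom W from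
    DFunLike.congr_fun this w
  refine cs.ext_simple fun i ↦ ?_
  rw [MonoidHom.comp_apply]
  by_cases h : i = s
  · subst h
    rw [retraction_simple_self, map_one]
    refine Equiv.ext fun l ↦ Subtype.ext ?_
    rw [mapHom_apply]
    refine ((List.map_congr_left fun x _ ↦ ?_).trans (List.map_id' l.1)).symm
    rw [smul_eq_of_retraction_eq cs hM i (h := 1), one_smul]
    rw [retraction_simple_self, map_one]
  · rw [retraction_simple_of_ne cs hM s h, treeAction_simple_of_ne cs hM s h]

theorem treeDist_treeAction (w : W) (l l' : Vertex (W ⧸ cs.linkSubgroup hM s)) :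
    treeDist (cs.treeAction hM s w l).1 (cs.treeAction hM s w l').1 = treeDist l.1 l'.1 := by
  induction w using cs.simple_induction generalizing l l' with
  | simple i =>
    by_cases h : i = s
    · subst h
      rw [treeAction_simple_self]
      exact treeDist_toggle _ l.2 l'.2
    · rw [treeAction_simple_of_ne cs hM s h]
      exact treeDist_map (MulAction.injective _) _ _
  | one => simp
  | mul w w' h h' => rw [map_mul, Equiv.Perm.mul_apply, Equiv.Perm.mul_apply, h, h']

/-- The empty word. -/
def root : Vertex (W ⧸ cs.linkSubgroup hM s) := ⟨[], List.isChain_nil⟩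

theorem mapHom_root (w : W) : mapHom W w (cs.root hM s) = cs.root hM s := rfl

theorem exists_smul_baseLetter (x : W ⧸ cs.linkSubgroup hM s) :
    ∃ h : W, h • cs.baseLetter hM s = x := by
  induction x using QuotientGroup.induction_on with
  | H k => exact ⟨k, congrArg _ (mul_one k)⟩

/-- A letter `h • baseLetter` is prepended by conjugating the toggle at the base letter by the
retraction of `h`. -/
theorem exists_treeAction_root (l : Vertex (W ⧸ cs.linkSubgroup hM s)) :
    ∃ w, cs.treeAction hM s w (cs.root hM s) = l := by
  obtain ⟨l, hl⟩ := l
  induction l with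
  | nil => exact ⟨1, by rw [map_one]; rfl⟩
  | cons x l ih =>
    obtain ⟨hx, hl'⟩ := isChain_cons_iff_notMem.1 hl
    obtain ⟨w, hw⟩ := ih hl'
    obtain ⟨h, rfl⟩ := cs.exists_smul_baseLetter hM s x
    refine ⟨cs.retraction hM {s}ᶜ h * cs.simple s * cs.retraction hM {s}ᶜ h⁻¹ * w, ?_⟩
    rw [map_mul, Equiv.Perm.mul_apply, hw, map_mul, map_mul, treeAction_retraction,
      treeAction_retraction, treeAction_simple_self]
    refine Subtype.ext ?_
    rw [Equiv.Perm.mul_apply, Equiv.Perm.mul_apply, mapHom_apply, togglePerm_apply, mapHom_apply,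
      ← toggle_map (MulAction.injective h)]
    simp only [List.map_map]
    rw [toggle_of_notMem]
    · simp [Function.comp_def]
    · simpa [Function.comp_def] using hx

/-- The reflection attached to a letter. -/
noncomputable def letterReflection (x : W ⧸ cs.linkSubgroup hM s) : W :=
  cs.retraction hM {s}ᶜ x.out * cs.simple s * (cs.retraction hM {s}ᶜ x.out)⁻¹

/-- Independence of the coset representative: two representatives differ by an element whose
retraction lies in the link parabolic and so commutes with `s`. -/
theorem letterReflection_mk (g : W) :
    cs.letterReflection hM s (g : W ⧸ cs.linkSubgroup hM s) =
      cs.retraction hM {s}ᶜ g * cs.simple s * (cs.retraction hM {s}ᶜ g)⁻¹ := by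
  obtain ⟨h, hh⟩ := QuotientGroup.mk_out_eq_mul (cs.linkSubgroup hM s) g
  have hc := cs.commute_of_mem_parabolic_link s (Subgroup.mem_comap.1 h.2)
  rw [letterReflection, hh, map_mul, mul_assoc (cs.retraction hM {s}ᶜ g), ← hc.eq]
  group

theorem letterReflection_baseLetter :
    cs.letterReflection hM s (cs.baseLetter hM s) = cs.simple s := by
  rw [baseLetter, letterReflection_mk]
  simp

theorem letterReflection_smul (g : W) (x : W ⧸ cs.linkSubgroup hM s) :
    cs.letterReflection hM s (g • x) =
      cs.retraction hM {s}ᶜ g * cs.letterReflection hM s x * (cs.retraction hM {s}ᶜ g)⁻¹ := by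
  induction x using QuotientGroup.induction_on with
  | H k =>
    have : g • (k : W ⧸ cs.linkSubgroup hM s) = ((g * k : W) : W ⧸ cs.linkSubgroup hM s) := rfl
    rw [this, letterReflection_mk, letterReflection_mk, map_mul]
    group

/-- The element attached to a word. -/
noncomputable def wordReflection (l : List (W ⧸ cs.linkSubgroup hM s)) : W :=
  (l.map (cs.letterReflection hM s)).prod

theorem wordReflection_map (g : W) (l : List (W ⧸ cs.linkSubgroup hM s)) :
    cs.wordReflection hM s (l.map (g • ·)) =
      cs.retraction hM {s}ᶜ g * cs.wordReflection hM s l * (cs.retraction hM {s}ᶜ g)⁻¹ := by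
  induction l with
  | nil => simp [wordReflection]
  | cons x l ih =>
    simp only [wordReflection, List.map_cons, List.prod_cons] at ih ⊢
    rw [ih, letterReflection_smul]
    group

theorem wordReflection_toggle {l : List (W ⧸ cs.linkSubgroup hM s)} (hl : l.IsChain (· ≠ ·)) :
    cs.wordReflection hM s (toggle (cs.baseLetter hM s) l) =
      cs.simple s * cs.wordReflection hM s l := by
  rcases toggle_cases (cs.baseLetter hM s) hl with ⟨k, rfl, h, -⟩ | ⟨-, h⟩
  · rw [h]
    simp [wordReflection, letterReflection_baseLetter]
  · rw [h]
    simp [wordReflection, letterReflection_baseLetter]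

/-- The semidirect decomposition of W as kernel of the retraction times W_{S∖s}; the kernel factor
is read off from the image of the root. It identifies the root stabilizer without a normal form
theorem. -/
theorem eq_wordReflection_mul_retraction (w : W) :
    w = cs.wordReflection hM s (cs.treeAction hM s w (cs.root hM s)).1 *
      cs.retraction hM {s}ᶜ w := by
  induction w using cs.simple_induction_left with
  | one => rw [map_one, map_one]; simp [wordReflection, root]
  | mul_simple_left w i ih =>
    rw [map_mul, map_mul, Equiv.Perm.mul_apply]
    by_cases h : i = s
    · subst h
      rw [treeAction_simple_self, togglePerm_apply, wordReflection_toggle cs hM i (Subtype.prop _),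
        retraction_simple_self, one_mul, mul_assoc, ← ih]
    · rw [treeAction_simple_of_ne cs hM s h, mapHom_apply, wordReflection_map,
        retraction_simple_of_ne cs hM s h]
      nth_rewrite 1 [ih]
      group

theorem mem_parabolic_of_fixes_root {w : W}
    (h : cs.treeAction hM s w (cs.root hM s) = cs.root hM s) : w ∈ cs.parabolic {s}ᶜ := by
  rw [cs.eq_wordReflection_mul_retraction hM s w, h]
  simpa [wordReflection, root] using cs.retraction_mem hM {s}ᶜ w

/-- The one-letter word at the base letter. -/
noncomputable def rootNeighbor : Vertex (W ⧸ cs.linkSubgroup hM s) :=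
  ⟨[cs.baseLetter hM s], List.isChain_singleton _⟩

theorem parabolic_mono {T U : Set B} (h : T ⊆ U) : cs.parabolic T ≤ cs.parabolic U :=
  Subgroup.closure_mono (Set.image_mono h)

theorem mem_parabolic_of_fixes_edge {w : W}
    (h : cs.treeAction hM s w (cs.root hM s) = cs.root hM s)
    (h' : cs.treeAction hM s w (cs.rootNeighbor hM s) = cs.rootNeighbor hM s) :
    w ∈ cs.parabolic {j | M s j = 2} := by
  have hw := cs.retraction_eq_self hM (cs.mem_parabolic_of_fixes_root hM s h)
  rw [← hw, treeAction_retraction] at h'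
  have h2 := congrArg Subtype.val h'
  rw [mapHom_apply] at h2
  simp only [rootNeighbor, List.map_cons, List.map_nil, List.cons.injEq, and_true] at h2
  rwa [smul_baseLetter_eq_iff, hw] at h2

/-- `s` swaps the ends of the edge, so after multiplying by `s` if necessary the element fixes both
ends and lies in the link parabolic. -/
theorem mem_parabolic_of_preserves_edge {w : W}
    (h : cs.treeAction hM s w (cs.root hM s) = cs.root hM s ∨
      cs.treeAction hM s w (cs.root hM s) = cs.rootNeighbor hM s)
    (h' : cs.treeAction hM s w (cs.rootNeighbor hM s) = cs.root hM s ∨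
      cs.treeAction hM s w (cs.rootNeighbor hM s) = cs.rootNeighbor hM s) :
    w ∈ cs.parabolic {j | j = s ∨ M s j = 2} := by
  have hne : cs.rootNeighbor hM s ≠ cs.root hM s := fun h ↦ by
    simpa [rootNeighbor, root] using congrArg Subtype.val h
  have t1 : cs.treeAction hM s (cs.simple s) (cs.root hM s) = cs.rootNeighbor hM s := by
    rw [treeAction_simple_self]; rfl
  have t2 : cs.treeAction hM s (cs.simple s) (cs.rootNeighbor hM s) = cs.root hM s := by
    rw [treeAction_simple_self]; exact Subtype.ext (toggle_cons _ _)
  have sub : cs.parabolic {j | M s j = 2} ≤ cs.parabolic {j | j = s ∨ M s j = 2} :=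
    cs.parabolic_mono fun j hj ↦ .inr hj
  rcases h with h | h
  · refine sub (cs.mem_parabolic_of_fixes_edge hM s h (h'.resolve_left fun h2 ↦ hne ?_))
    exact (cs.treeAction hM s w).injective (h2.trans h.symm)
  · have h2 := h'.resolve_right fun h2 ↦
      hne ((cs.treeAction hM s w).injective (h2.trans h.symm))
    have h3 : cs.simple s * w ∈ cs.parabolic {j | j = s ∨ M s j = 2} := by
      refine sub (cs.mem_parabolic_of_fixes_edge hM s ?_ ?_)
      · rw [map_mul, Equiv.Perm.mul_apply, h, t2]
      · rw [map_mul, Equiv.Perm.mul_apply, h2, t1]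
    have h4 : cs.simple s ∈ cs.parabolic {j | j = s ∨ M s j = 2} :=
      cs.simple_mem_parabolic (.inl rfl)
    exact (Subgroup.mul_mem_cancel_left _ h4).1 h3

/-- A finite subgroup fixes a vertex or preserves an edge of the tree. -/
theorem exists_conj_le_parabolic_compl_or_star (hM : IsRightAngledMatrix M) (s : B)
    (F : Subgroup W) [Finite F] :
    ∃ g : W, (∀ f ∈ F, g * f * g⁻¹ ∈ cs.parabolic {s}ᶜ) ∨
      ∀ f ∈ F, g * f * g⁻¹ ∈ cs.parabolic {j | j = s ∨ M s j = 2} := by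
  classical
  have := Fintype.ofFinite F
  let α := cs.treeAction hM s
  -- Radius of the `F`-orbit of the root as seen from `c`; its minimizers are the circumcentres, and
  -- `F` permutes them.
  let rad : Vertex (W ⧸ cs.linkSubgroup hM s) → ℕ := fun c ↦
    Finset.univ.sup fun f : F ↦ treeDist c.1 (α f (cs.root hM s)).1
  have rad_le (c) (f : F) : treeDist c.1 (α f (cs.root hM s)).1 ≤ rad c :=
    Finset.le_sup (f := fun f : F ↦ treeDist c.1 (α f (cs.root hM s)).1) (Finset.mem_univ f)
  have rad_inv (f : F) (c) : rad (α f c) ≤ rad c := by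
    refine Finset.sup_le fun f' _ ↦ ?_
    have : α f' (cs.root hM s) = α f (α (f⁻¹ * f' : F) (cs.root hM s)) := by
      rw [← Equiv.Perm.mul_apply, ← map_mul]; simp
    rw [this, treeDist_treeAction]
    exact rad_le _ _
  obtain ⟨c, hc⟩ : ∃ c, ∀ c', rad c ≤ rad c' := by
    have : Nonempty (Vertex (W ⧸ cs.linkSubgroup hM s)) := ⟨cs.root hM s⟩
    exact ⟨Function.argmin rad, fun c' ↦ Function.argmin_le rad c'⟩
  -- If two minimizers were at distance at least 2, the vertex after the first on the geodesic
  -- joining them would have smaller radius. Transitivity moves the first one to the root.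
  have close (z z') (hz : rad z = rad c) (hz' : rad z' = rad c) : treeDist z.1 z'.1 ≤ 1 := by
    obtain ⟨g, rfl⟩ := cs.exists_treeAction_root hM s z
    obtain ⟨l, rfl⟩ := (cs.treeAction hM s g).surjective z'
    rw [treeDist_treeAction]
    by_contra! hlt
    obtain ⟨l, hl⟩ := l
    match l with
    | [] => simp [root, treeDist] at hlt
    | [a] => simp [root, treeDist] at hlt
    | a :: b :: l =>
      have hm (f : F) : treeDist (α g ⟨[a], List.isChain_singleton _⟩).1
          (α f (cs.root hM s)).1 < rad c := by
        obtain ⟨k, hk⟩ := (cs.treeAction hM s g).surjective (α f (cs.root hM s))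
        have h1 := rad_le (cs.treeAction hM s g (cs.root hM s)) f
        have h2 := rad_le (cs.treeAction hM s g ⟨a :: b :: l, hl⟩) f
        rw [← hk, treeDist_treeAction] at h1 h2 ⊢
        rw [hz] at h1
        rw [hz'] at h2
        exact (treeDist_singleton_lt (List.cons_ne_nil b l) k.1).trans_le (max_le h1 h2)
      exact absurd (hc _) (not_le.2 ((Finset.sup_lt_iff (bot_le.trans_lt (hm 1))).2
        fun f _ ↦ hm f))
  obtain ⟨g, rfl⟩ := cs.exists_treeAction_root hM s c
  have stab (f : F) (z) (hz : rad z = rad (cs.treeAction hM s g (cs.root hM s))) :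
      rad (α f z) = rad (cs.treeAction hM s g (cs.root hM s)) :=
    le_antisymm ((rad_inv f z).trans hz.le) (hc _)
  by_cases hfix : ∀ f ∈ F, α f (cs.treeAction hM s g (cs.root hM s)) =
      cs.treeAction hM s g (cs.root hM s)
  · refine ⟨g⁻¹, .inl fun f hf ↦ cs.mem_parabolic_of_fixes_root hM s ?_⟩
    rw [map_mul, map_mul, inv_inv, Equiv.Perm.mul_apply, Equiv.Perm.mul_apply]
    rw [show cs.treeAction hM s f _ = _ from hfix f hf]
    simp
  push Not at hfix
  obtain ⟨f₀, hf₀, hne⟩ := hfix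
  obtain ⟨⟨l, hl⟩, hlz⟩ := (cs.treeAction hM s g).surjective
    (α f₀ (cs.treeAction hM s g (cs.root hM s)))
  have hz₀ := stab ⟨f₀, hf₀⟩ _ rfl
  change rad (α f₀ (cs.treeAction hM s g (cs.root hM s))) = _ at hz₀
  rw [← hlz] at hz₀ hne
  have hd := close _ _ rfl hz₀
  rw [treeDist_treeAction] at hd
  match l with
  | [] => exact absurd rfl hne
  | _ :: _ :: _ => simp [root, treeDist] at hd
  | [x] =>
    obtain ⟨h, rfl⟩ := cs.exists_smul_baseLetter hM s x
    -- The second factor fixes the root and moves the base letter to `x`, so `g'` carries the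
    -- standard edge onto the edge of circumcentres.
    set g' := g * cs.retraction hM {s}ᶜ h with hg'
    have e1 : α g' (cs.root hM s) = cs.treeAction hM s g (cs.root hM s) := by
      change cs.treeAction hM s g' _ = _
      rw [hg', map_mul, treeAction_retraction, Equiv.Perm.mul_apply, mapHom_root]
    have e2 : α g' (cs.rootNeighbor hM s) =
        cs.treeAction hM s g ⟨[h • cs.baseLetter hM s], hl⟩ := by
      change cs.treeAction hM s g' _ = _
      rw [hg', map_mul, treeAction_retraction, Equiv.Perm.mul_apply]
      rfl
    rw [← e2] at hz₀
    have r1 : rad (α g' (cs.root hM s)) = rad (cs.treeAction hM s g (cs.root hM s)) := by rw [e1]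
    -- In a tree, a vertex within distance 1 of both ends of an edge is one of the ends.
    have two (z) (hz : rad z = rad (cs.treeAction hM s g (cs.root hM s))) :
        α g'⁻¹ z = cs.root hM s ∨ α g'⁻¹ z = cs.rootNeighbor hM s := by
      obtain ⟨⟨l, hl⟩, rfl⟩ := (cs.treeAction hM s g').surjective z
      have d1 := close _ _ r1 hz
      have d2 := close _ _ hz₀ hz
      rw [treeDist_treeAction] at d1 d2
      rw [← Equiv.Perm.mul_apply, ← map_mul, inv_mul_cancel, map_one, Equiv.Perm.one_apply]
      match l with
      | [] => exact .inl rfl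
      | _ :: _ :: _ => simp [root, treeDist] at d1
      | [y] =>
        right
        by_cases hy : cs.baseLetter hM s = y
        · subst hy; rfl
        · simp [rootNeighbor, treeDist, hy] at d2
    refine ⟨g'⁻¹, .inr fun f hf ↦ cs.mem_parabolic_of_preserves_edge hM s ?_ ?_⟩
    · rw [map_mul, map_mul, inv_inv, Equiv.Perm.mul_apply, Equiv.Perm.mul_apply]
      exact two _ (stab ⟨f, hf⟩ _ r1)
    · rw [map_mul, map_mul, inv_inv, Equiv.Perm.mul_apply, Equiv.Perm.mul_apply]
      exact two _ (stab ⟨f, hf⟩ _ hz₀)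

end CoxeterSystem

/-! ### Finite subgroups and cliques -/

namespace CoxeterSystem

variable {B W : Type*} [Group W] {M : CoxeterMatrix B} (cs : CoxeterSystem M W)

/-- A finite subgroup of a right-angled Coxeter group is conjugate into a parabolic subgroup whose
generators pairwise commute. -/
theorem exists_conj_le_parabolic_clique [Finite B] (hM : IsRightAngledMatrix M) (F : Subgroup W)
    [Finite F] :
    ∃ T : Set B, (∀ i ∈ T, ∀ j ∈ T, i ≠ j → M i j = 2) ∧
      ∃ g : W, ∀ f ∈ F, g * f * g⁻¹ ∈ cs.parabolic T := by
  let P : Set B → Prop := fun T ↦ ∃ g : W, ∀ f ∈ F, g * f * g⁻¹ ∈ cs.parabolic T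
  have hP : P Set.univ := by
    refine ⟨1, fun f _ ↦ ?_⟩
    rw [parabolic, Set.image_univ, cs.subgroup_closure_range_simple]
    trivial
  obtain ⟨T, hT⟩ := (Set.toFinite {T | P T}).exists_minimal ⟨_, hP⟩
  -- Retracting the conjugate in W_U onto W_T gives a conjugate in W_{T∩U}, so a minimal `T` is in
  -- fact the least one.
  have step (U : Set B) (hU : P U) : T ⊆ U := by
    obtain ⟨g, hg⟩ := hT.prop
    obtain ⟨k, hk⟩ := hU
    have : P (T ∩ U) := by
      refine ⟨cs.retraction hM T (k * g⁻¹) * g, fun f hf ↦ ?_⟩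
      have h := cs.retraction_mem_inter hM T U (hk f hf)
      have e : k * f * k⁻¹ = (k * g⁻¹) * (g * f * g⁻¹) * (k * g⁻¹)⁻¹ := by group
      rw [e, map_mul, map_mul, map_inv, cs.retraction_eq_self hM (hg f hf)] at h
      convert h using 1
      group
    exact fun i hi ↦ (hT.le_of_le this Set.inter_subset_left hi).2
  refine ⟨T, fun i hi j hj hij ↦ ?_, hT.prop⟩
  obtain ⟨g, hg | hg⟩ := cs.exists_conj_le_parabolic_compl_or_star hM i F
  · exact absurd rfl (step _ ⟨g, hg⟩ hi)
  · exact (step _ ⟨g, hg⟩ hj).resolve_left hij.symm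

theorem commute_of_mem_parabolic_clique {T : Set B}
    (hT : ∀ i ∈ T, ∀ j ∈ T, i ≠ j → M i j = 2) {x y : W} (hx : x ∈ cs.parabolic T)
    (hy : y ∈ cs.parabolic T) : Commute x y := by
  refine Subgroup.closure_induction₂ (p := fun x y _ _ ↦ Commute x y) ?_
    (fun x _ ↦ .one_left x) (fun x _ ↦ .one_right x) (fun x y z _ _ _ h h' ↦ h.mul_left h')
    (fun x y z _ _ _ h h' ↦ h.mul_right h') (fun x y _ _ h ↦ h.inv_left)
    (fun x y _ _ h ↦ h.inv_right) hx hy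
  rintro _ _ ⟨i, hi, rfl⟩ ⟨j, hj, rfl⟩
  rcases eq_or_ne i j with rfl | hij
  · exact .refl _
  · exact cs.commute_simple_of_eq_two (hT i hi j hj hij)

theorem mul_self_of_mem_parabolic_clique {T : Set B}
    (hT : ∀ i ∈ T, ∀ j ∈ T, i ≠ j → M i j = 2) {x : W} (hx : x ∈ cs.parabolic T) :
    x * x = 1 := by
  induction hx using Subgroup.closure_induction with
  | mem x hx => obtain ⟨i, -, rfl⟩ := hx; simp
  | one => simp
  | mul x y hx hy h h' =>
    have hc := cs.commute_of_mem_parabolic_clique hT hx hy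
    rw [mul_assoc, ← mul_assoc y, ← hc.eq, mul_assoc x y, h', mul_one, h]
  | inv x _ h => rw [← mul_inv_rev, h, inv_one]

end CoxeterSystem

/-! ### Passage to the abelianization and comparison of nerves -/

theorem Subgroup.map_abelianization_le_of_conj {W : Type*} [Group W] {F H : Subgroup W} {g : W}
    (h : ∀ f ∈ F, g * f * g⁻¹ ∈ H) : F.map Abelianization.of ≤ H.map Abelianization.of := by
  rintro _ ⟨f, hf, rfl⟩
  refine ⟨_, h f hf, ?_⟩
  rw [map_mul, map_mul, map_inv, mul_comm, inv_mul_cancel_left]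

/-- The closure of a finite set of pairwise commuting involutions is finite. -/
theorem finite_closure_of_commuting_involutions {W : Type*} [Group W] {A : Set W} (hA : A.Finite)
    (hc : ∀ a ∈ A, ∀ b ∈ A, a * b = b * a) (hsq : ∀ x ∈ Subgroup.closure A, x * x = 1) :
    Finite (Subgroup.closure A) := by
  have hcomm := (Subgroup.isMulCommutative_closure hc).is_comm
  let _ : CommGroup (Subgroup.closure A) := { mul_comm := hcomm.comm }
  have : Group.FG (Subgroup.closure A) := by
    rw [Group.fg_iff_subgroup_fg]
    exact ⟨hA.toFinset, by simp⟩
  refine CommGroup.finite_of_fg_isMulTorsion _ fun x ↦ isOfFinOrder_iff_pow_eq_one.2 ⟨2, by simp, ?_⟩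
  exact Subtype.ext ((pow_two _).trans (hsq x x.2))

namespace IsRightAngledCoxeterGenerators

variable {W : Type*} [Group W] {S : Set W}

/-- A finite subgroup has the same image in the abelianization as a subgroup of some finite
standard subgroup, and its elements are involutions. -/
theorem finite_subgroup (hS : IsRightAngledCoxeterGenerators S) (F : Subgroup W) [Finite F] :
    (∀ f ∈ F, f * f = 1) ∧ ∃ A ⊆ S, Finite (standardSubgroup A) ∧
      F.map Abelianization.of ≤ abelianizedStandardSubgroup A := by
  obtain ⟨M, ⟨hfin, cs, hcs⟩, hM⟩ := hS
  have : Finite S := hfin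
  obtain ⟨T, hT, g, hg⟩ := cs.exists_conj_le_parabolic_clique hM F
  refine ⟨fun f hf ↦ ?_, cs.simple '' T, ?_, ?_, Subgroup.map_abelianization_le_of_conj hg⟩
  · have h := cs.mul_self_of_mem_parabolic_clique hT (hg f hf)
    have e : g * f * g⁻¹ * (g * f * g⁻¹) = g * (f * f) * g⁻¹ := by group
    rwa [e, conj_eq_one_iff] at h
  · rintro _ ⟨i, -, rfl⟩
    rw [hcs]
    exact i.2
  · refine finite_closure_of_commuting_involutions (T.toFinite.image _) ?_
      fun x hx ↦ cs.mul_self_of_mem_parabolic_clique hT hx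
    exact fun a ha b hb ↦ cs.commute_of_mem_parabolic_clique hT
      (Subgroup.subset_closure ha) (Subgroup.subset_closure hb)

theorem mul_self_of_isOfFinOrder (hS : IsRightAngledCoxeterGenerators S) {g : W}
    (hg : IsOfFinOrder g) : g * g = 1 := by
  have : Finite (Subgroup.zpowers g) := hg.finite_zpowers
  exact (hS.finite_subgroup (Subgroup.zpowers g)).1 g (Subgroup.mem_zpowers g)

open Classical in
/-- Any set of Coxeter generators of a right-angled Coxeter group is right-angled. -/
theorem of_isCoxeterGenerators (hS : IsRightAngledCoxeterGenerators S) {S' : Set W}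
    (hS' : IsCoxeterGenerators S') : IsRightAngledCoxeterGenerators S' := by
  obtain ⟨M, hfin, cs, hcs⟩ := hS'
  have sq (i j : S') (h : M i j ≠ 0) : (cs.simple i * cs.simple j) ^ 2 = 1 := by
    rw [pow_two]
    exact hS.mul_self_of_isOfFinOrder
      (isOfFinOrder_iff_pow_eq_one.2 ⟨M i j, Nat.pos_of_ne_zero h, cs.simple_mul_simple_pow i j⟩)
  -- With `(st)^2 = 1`, an odd exponent would give `s = t`. Evenness lets each relation of `M`
  -- follow from the one with exponent 2, so `N` presents the same group.
  have even (i j : S') (hij : i ≠ j) (h : M i j ≠ 0) : Even (M i j) := by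
    by_contra hodd
    obtain ⟨k, hk⟩ := Nat.not_even_iff_odd.1 hodd
    have h1 := cs.simple_mul_simple_pow i j
    rw [hk, pow_succ, pow_mul, sq i j h, one_pow, one_mul, mul_eq_one_iff_eq_inv,
      cs.inv_simple, hcs, hcs] at h1
    exact hij (Subtype.ext h1)
  let N : CoxeterMatrix S' :=
    { M := Matrix.of fun i j ↦ if i = j then 1 else if M i j = 0 then 0 else 2
      isSymm := by
        ext i j
        simp [M.symmetric i j, eq_comm]
      diagonal := by simp
      off_diagonal := by
        intro i j hij
        simp only [Matrix.of_apply, if_neg hij]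
        split_ifs <;> simp }
  have hN (i j : S') : N i j = if i = j then 1 else if M i j = 0 then 0 else 2 := rfl
  let fwd : W →* N.Group := cs.lift ⟨N.simple, by
    intro i j
    have h := N.toCoxeterSystem.simple_mul_simple_pow i j
    rw [N.toCoxeterSystem_simple] at h
    rcases eq_or_ne i j with rfl | hij
    · simpa using h
    · rw [hN, if_neg hij] at h
      by_cases h0 : M i j = 0
      · rw [h0, pow_zero]
      · rw [if_neg h0] at h
        obtain ⟨k, hk⟩ := (even i j hij h0).two_dvd
        rw [hk, pow_mul, h, one_pow]⟩
  have hlift : N.IsLiftable cs.simple := by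
    intro i j
    rw [hN]
    split_ifs with hij h0
    · subst hij; simp
    · simp
    · exact sq i j h0
  let bwd : N.Group →* W := N.toCoxeterSystem.lift ⟨cs.simple, hlift⟩
  have hf (i : S') : fwd (cs.simple i) = N.simple i := cs.lift_apply_simple _ i
  have hb (i : S') : bwd (N.simple i) = cs.simple i := by
    have := N.toCoxeterSystem.lift_apply_simple hlift i
    rwa [N.toCoxeterSystem_simple] at this
  let e : W ≃* N.Group := MonoidHom.toMulEquiv fwd bwd
    (cs.ext_simple fun i ↦ by simp [hf, hb])
    (N.toCoxeterSystem.ext_simple fun i ↦ by simp [hf, hb, N.toCoxeterSystem_simple])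
  refine ⟨N, ⟨hfin, ⟨e⟩, fun i ↦ (hb i).trans (hcs i)⟩, fun i j hij ↦ ?_⟩
  rw [hN, if_neg hij]
  split_ifs <;> simp

/-- The elements of the abelianization of a right-angled Coxeter group correspond to the subsets
of the generating set. -/
theorem exists_support (hS : IsRightAngledCoxeterGenerators S) :
    ∃ supp : Abelianization W → Set W, Function.Injective supp ∧
      (∀ A ⊆ S, ∀ x, x ∈ abelianizedStandardSubgroup A ↔ supp x ⊆ A) ∧
      ∀ A ⊆ S, ∃ x, supp x = A := by
  classical
  obtain ⟨M, ⟨hfin, cs, hcs⟩, hM⟩ := hS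
  have : Fintype S := hfin.fintype
  -- The coordinate characters, dual to the classes `q i`; they recover `T` from the product `X T`.
  let χ (j : S) : Abelianization W →* Multiplicative (ZMod 2) := Abelianization.lift <|
    cs.lift ⟨fun i ↦ if i = j then Multiplicative.ofAdd 1 else 1,
      CoxeterSystem.IsRightAngledMatrix.isLiftable hM
        (fun i ↦ by split_ifs <;> rfl) (fun _ _ _ ↦ Commute.all _ _)⟩
  let q (i : S) : Abelianization W := Abelianization.of (cs.simple i)
  have hχ (i j : S) : χ j (q i) = if i = j then Multiplicative.ofAdd 1 else 1 := by
    simp only [χ, q, Abelianization.lift_apply_of]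
    exact cs.lift_apply_simple _ i
  have hqq (i : S) : q i * q i = 1 := by simp [q, ← map_mul]
  let X (T : Finset S) : Abelianization W := ∏ i ∈ T, q i
  have hX (T : Finset S) (j : S) : χ j (X T) = if j ∈ T then Multiplicative.ofAdd 1 else 1 := by
    simp only [X, map_prod, hχ, Finset.prod_ite_eq']
  have exX (x : Abelianization W) : ∃ T, X T = x := by
    obtain ⟨w, rfl⟩ := QuotientGroup.mk_surjective x
    change ∃ T, X T = Abelianization.of w
    induction w using cs.simple_induction_left with
    | one => exact ⟨∅, by simp [X]⟩
    | mul_simple_left w i ih =>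
      obtain ⟨T, hT⟩ := ih
      rw [map_mul, ← hT]
      change ∃ T', X T' = q i * X T
      by_cases hi : i ∈ T
      · refine ⟨T.erase i, ?_⟩
        have := Finset.mul_prod_erase T q hi
        simp only [X]
        rw [← this, ← mul_assoc, hqq, one_mul]
      · exact ⟨insert i T, Finset.prod_insert hi⟩
  let supp (x : Abelianization W) : Set W := {w | ∃ h : w ∈ S, χ ⟨w, h⟩ x ≠ 1}
  have hsupp (T : Finset S) : supp (X T) = (↑) '' (T : Set S) := by
    ext w
    simp only [supp, hX, Set.mem_ofPred_eq, Set.mem_image, Finset.mem_coe]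
    constructor
    · rintro ⟨h, h'⟩
      refine ⟨⟨w, h⟩, by_contra fun hn ↦ h' (if_neg hn), rfl⟩
    · rintro ⟨i, hi, rfl⟩
      refine ⟨i.2, ?_⟩
      rw [if_pos hi]
      decide
  refine ⟨supp, ?_, ?_, ?_⟩
  · intro x y hxy
    obtain ⟨T, rfl⟩ := exX x
    obtain ⟨U, rfl⟩ := exX y
    rw [hsupp, hsupp] at hxy
    rw [Finset.coe_injective (Subtype.val_injective.image_injective hxy)]
  · intro A hA x
    constructor
    · rintro ⟨w, hw, rfl⟩ v ⟨hv, hne⟩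
      by_contra hvA
      refine hne ?_
      change Abelianization.of w ∈ (χ ⟨v, hv⟩).ker
      change w ∈ (χ ⟨v, hv⟩).ker.comap Abelianization.of
      refine (Subgroup.closure_le _).2 (fun a ha ↦ ?_) hw
      have h1 := hχ ⟨a, hA ha⟩ ⟨v, hv⟩
      rw [if_neg (fun h ↦ hvA (by simpa [← Subtype.mk.inj h] using ha))] at h1
      simp only [q, hcs] at h1
      exact h1
    · obtain ⟨T, rfl⟩ := exX x
      rw [hsupp]
      intro h
      refine Subgroup.prod_mem _ fun i hi ↦ ?_
      refine ⟨cs.simple i, Subgroup.subset_closure ?_, rfl⟩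
      rw [hcs]
      exact h ⟨i, hi, rfl⟩
  · intro A hA
    refine ⟨X (Finset.univ.filter fun i : S ↦ (i : W) ∈ A), ?_⟩
    rw [hsupp]
    ext w
    simp only [Finset.coe_filter, Finset.mem_univ, true_and, Set.mem_image, Set.mem_ofPred_eq,
      Subtype.exists, exists_and_left, exists_prop, exists_eq_right_right]
    exact ⟨fun h ↦ h.1, fun h ↦ ⟨h, hA h⟩⟩

theorem finite (hS : IsRightAngledCoxeterGenerators S) : S.Finite := by
  obtain ⟨M, ⟨hfin, -⟩, -⟩ := hS
  exact hfin

theorem abelianizedStandardSubgroup_le_iff (hS : IsRightAngledCoxeterGenerators S) {A A' : Set W}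
    (hA : A ⊆ S) (hA' : A' ⊆ S) :
    abelianizedStandardSubgroup A ≤ abelianizedStandardSubgroup A' ↔ A ⊆ A' := by
  refine ⟨fun h ↦ ?_, fun h ↦ Subgroup.map_mono (Subgroup.closure_mono h)⟩
  obtain ⟨supp, -, h2, h3⟩ := hS.exists_support
  obtain ⟨x, rfl⟩ := h3 A hA
  exact (h2 A' hA' x).1 (h ((h2 _ hA x).2 subset_rfl))

theorem abelianizedStandardSubgroup_inj (hS : IsRightAngledCoxeterGenerators S) {A A' : Set W}
    (hA : A ⊆ S) (hA' : A' ⊆ S)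
    (h : abelianizedStandardSubgroup A = abelianizedStandardSubgroup A') : A = A' :=
  subset_antisymm ((hS.abelianizedStandardSubgroup_le_iff hA hA').1 h.le)
    ((hS.abelianizedStandardSubgroup_le_iff hA' hA).1 h.ge)

/-- Supports turn the intersection of subgroups into the power set of the intersection of the `A i`.
The left side depends only on subgroups of the abelianization, so it can be compared across
generating sets. -/
theorem ncard_iInter_abelianizedStandardSubgroup (hS : IsRightAngledCoxeterGenerators S)
    {ι : Type*} [Nonempty ι] (A : ι → Set W) (hA : ∀ i, A i ⊆ S) :
    (⋂ i, (abelianizedStandardSubgroup (A i) : Set (Abelianization W))).ncard =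
      2 ^ (⋂ i, A i).ncard := by
  obtain ⟨supp, h1, h2, h3⟩ := hS.exists_support
  have hsub : ⋂ i, A i ⊆ S := fun x hx ↦ hA (Classical.arbitrary ι) (Set.mem_iInter.1 hx _)
  rw [← Set.ncard_powerset _ (hS.finite.subset hsub), ← Set.ncard_image_of_injective _ h1]
  congr 1
  ext C
  simp only [Set.mem_image, Set.mem_iInter, SetLike.mem_coe, Set.mem_powerset_iff,
    Set.subset_iInter_iff]
  constructor
  · rintro ⟨x, hx, rfl⟩ i
    exact (h2 _ (hA i) x).1 (hx i)
  · intro h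
    obtain ⟨x, rfl⟩ := h3 C ((h (Classical.arbitrary ι)).trans (hA _))
    exact ⟨x, fun i ↦ (h2 _ (hA i) x).2 (h i), rfl⟩

/-- Each maximal simplex of the nerve has a partner with the same image in the abelianization. -/
theorem exists_mem_maximalNerve (hS : IsRightAngledCoxeterGenerators S) {S' : Set W}
    (hS' : IsRightAngledCoxeterGenerators S') {A : Set W} (hA : A ∈ maximalNerve S) :
    ∃ A' ∈ maximalNerve S', abelianizedStandardSubgroup A = abelianizedStandardSubgroup A' := by
  obtain ⟨⟨⟨a, ha⟩, hAS, hAfin⟩, hmax⟩ := hA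
  obtain ⟨-, A₀, hA₀, hA₀fin, hle₀⟩ := hS'.finite_subgroup (standardSubgroup A)
  -- The empty set is admitted here, since `finite_subgroup` does not exclude it; it is ruled out at
  -- the end because q(W_∅) is trivial.
  have hfin : {C | C ⊆ S' ∧ Finite (standardSubgroup C)}.Finite :=
    hS'.finite.finite_subsets.subset fun C hC ↦ hC.1
  obtain ⟨A', hle, hA'⟩ := hfin.exists_le_maximal ⟨hA₀, hA₀fin⟩
  obtain ⟨hA'S, hA'fin⟩ := hA'.prop
  obtain ⟨-, C, hC, hCfin, hle'⟩ := hS.finite_subgroup (standardSubgroup A')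
  have h1 : abelianizedStandardSubgroup A ≤ abelianizedStandardSubgroup A' :=
    hle₀.trans ((hS'.abelianizedStandardSubgroup_le_iff hA₀ hA'S).2 hle)
  have hAC := (hS.abelianizedStandardSubgroup_le_iff hAS hC).1 (h1.trans hle')
  have hAC' : A = C := hmax C ⟨⟨a, hAC ha⟩, hC, hCfin⟩ hAC
  have heq : abelianizedStandardSubgroup A = abelianizedStandardSubgroup A' :=
    le_antisymm h1 (hAC' ▸ hle')
  refine ⟨A', ⟨⟨?_, hA'S, hA'fin⟩, fun D hD hsub ↦ ?_⟩, heq⟩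
  · by_contra hempty
    rw [Set.not_nonempty_iff_eq_empty] at hempty
    rw [hempty] at heq
    exact (hS.abelianizedStandardSubgroup_inj hAS (Set.empty_subset S) heq ▸ ha : a ∈ (∅ : Set W))
  · exact subset_antisymm hsub (hA'.le_of_ge ⟨hD.2.1, hD.2.2⟩ hsub)

end IsRightAngledCoxeterGenerators

/-! ### Inclusion-exclusion and the main theorem -/

/-- Splitting along `k (C 0)` trades one removed set for one more intersected set; this is the
induction step on the number of removed sets. -/
theorem Set.ncard_iInter_diff_iUnion_succ {ι α : Type*} (k : ι → Set α) (hk : ∀ i, (k i).Finite)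
    {r s : ℕ} (A : Fin (r + 1) → ι) (C : Fin (s + 1) → ι) :
    ((⋂ i, k (A i)) \ ⋃ j, k (C j)).ncard +
      ((⋂ i, k ((Fin.cons (C 0) A : Fin (r + 2) → ι) i)) \ ⋃ j, k (Fin.tail C j)).ncard =
    ((⋂ i, k (A i)) \ ⋃ j, k (Fin.tail C j)).ncard := by
  have hfin : ((⋂ i, k (A i)) \ ⋃ j, k (Fin.tail C j)).Finite :=
    (hk (A 0)).subset (Set.sdiff_subset.trans (Set.iInter_subset _ 0))
  rw [← Set.ncard_inter_add_ncard_sdiff_eq_ncard _ (k (C 0)) hfin, add_comm]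
  congr 2
  · ext x
    simp [Fin.forall_fin_succ (P := fun i ↦ x ∈ k ((Fin.cons (C 0) A : Fin (r + 2) → ι) i))]
    tauto
  · ext x
    simp [Fin.forall_fin_succ (P := fun j ↦ x ∉ k (C j)), Fin.tail]
    tauto

/-- Inclusion-exclusion: a correspondence of finite sets that preserves the sizes of intersections
also preserves the sizes of differences of intersections and unions. -/
theorem Set.ncard_iInter_diff_iUnion_eq {ι α β : Type*} (f : ι → Set α) (g : ι → Set β)
    (hf : ∀ i, (f i).Finite) (hg : ∀ i, (g i).Finite)
    (h : ∀ (r : ℕ) (A : Fin (r + 1) → ι), (⋂ i, f (A i)).ncard = (⋂ i, g (A i)).ncard)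
    (s r : ℕ) (A : Fin (r + 1) → ι) (C : Fin s → ι) :
    ((⋂ i, f (A i)) \ ⋃ j, f (C j)).ncard = ((⋂ i, g (A i)) \ ⋃ j, g (C j)).ncard := by
  induction s generalizing r with
  | zero => simpa using h r A
  | succ s ih =>
    have h1 := Set.ncard_iInter_diff_iUnion_succ f hf A C
    have h2 := Set.ncard_iInter_diff_iUnion_succ g hg A C
    have h3 := ih r A (Fin.tail C)
    have h4 := ih (r + 1) (Fin.cons (C 0) A) (Fin.tail C)
    omega

theorem mainTheorem3 {W : Type*} [Group W] (S S' : Set W)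
    (hS : IsRightAngledCoxeterGenerators S) (hS' : IsCoxeterGenerators S') :
    (∀ A ∈ maximalNerve S, ∃! A' : Set W, A' ∈ maximalNerve S' ∧
      abelianizedStandardSubgroup A = abelianizedStandardSubgroup A') ∧
    ∃ star : maximalNerve S → maximalNerve S',
      (∀ A : maximalNerve S,
        abelianizedStandardSubgroup (A : Set W) =
          abelianizedStandardSubgroup (star A : Set W)) ∧
      Function.Bijective star ∧
      (∀ (r : ℕ) (A : Fin r → maximalNerve S), 1 ≤ r →
        (⋂ i, (A i : Set W)).ncard = (⋂ i, (star (A i) : Set W)).ncard) ∧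
      (∀ (r s : ℕ) (A : Fin r → maximalNerve S) (B : Fin s → maximalNerve S), 1 ≤ r →
        ((⋂ i, (A i : Set W)) \ ⋃ j, (B j : Set W)).ncard =
          ((⋂ i, (star (A i) : Set W)) \ ⋃ j, (star (B j) : Set W)).ncard) := by
  replace hS' := hS.of_isCoxeterGenerators hS'
  have sub {S : Set W} (A : maximalNerve S) : (A : Set W) ⊆ S := A.2.1.2.1
  choose star' hstar' heq' using fun A : maximalNerve S ↦ hS.exists_mem_maximalNerve hS' A.2
  let star (A : maximalNerve S) : maximalNerve S' := ⟨star' A, hstar' A⟩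
  have heq (A : maximalNerve S) : abelianizedStandardSubgroup (A : Set W) =
      abelianizedStandardSubgroup (star A : Set W) := heq' A
  have hcard (r : ℕ) (A : Fin (r + 1) → maximalNerve S) :
      (⋂ i, (A i : Set W)).ncard = (⋂ i, (star (A i) : Set W)).ncard := by
    have h1 := hS.ncard_iInter_abelianizedStandardSubgroup (fun i ↦ (A i : Set W)) fun i ↦ sub _
    have h2 := hS'.ncard_iInter_abelianizedStandardSubgroup (fun i ↦ (star (A i) : Set W))
      fun i ↦ sub _
    simp only [heq] at h1
    exact Nat.pow_right_injective le_rfl (h1.symm.trans h2)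
  refine ⟨fun A hA ↦ ?_, star, heq, ⟨fun A C h ↦ ?_, fun C ↦ ?_⟩, ?_, ?_⟩
  · obtain ⟨A', hA', h⟩ := hS.exists_mem_maximalNerve hS' hA
    exact ⟨A', ⟨hA', h⟩, fun D hD ↦ hS'.abelianizedStandardSubgroup_inj hD.1.1.2.1 hA'.1.2.1
      (hD.2.symm.trans h)⟩
  · exact Subtype.ext (hS.abelianizedStandardSubgroup_inj (sub A) (sub C)
      ((heq A).trans (h ▸ (heq C).symm)))
  · obtain ⟨A, hA, h⟩ := hS'.exists_mem_maximalNerve hS C.2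
    exact ⟨⟨A, hA⟩, Subtype.ext (hS'.abelianizedStandardSubgroup_inj (sub _) (sub C)
      ((heq ⟨A, hA⟩).symm.trans h.symm))⟩
  · rintro (_ | r) A hr
    · omega
    · exact hcard r A
  · rintro (_ | r) s A C hr
    · omega
    · exact Set.ncard_iInter_diff_iUnion_eq (fun A : maximalNerve S ↦ (A : Set W))
        (fun A ↦ (star A : Set W)) (fun A ↦ hS.finite.subset (sub A))
        (fun A ↦ hS'.finite.subset (sub _)) hcard s r A C
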